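/- Let $\mathcal H$ be a real separable Hilbert space, $I$ the identity operator, and $J=\begin{bmatrix}0&I\\-I&0\end{bmatrix}$ on $\mathcal H\oplus\mathcal H$. For a bounded real linear operator $A$ let $\hat A(x+iy)=Ax+iAy$ be its complexification. A bounded symmetric invertible operator $S$ on $\mathcal H\oplus\mathcal H$ is called a *Gaussian covariance operator* if (1) $\hat S-i\hat J\ge 0$; (2) $S-I$ is Hilbert–Schmidt; (3) $(\sqrt S J\sqrt S)^T(\sqrt S J\sqrt S)-I$ is of trace class (where $\sqrt S$ is the positive square root of $S$, which is positive by (1)). A *Williamson form* of $S$ is a representation $S=M^T\begin{bmatrix}D&0\\0&D\end{bmatrix}M$ with $D$ a positive invertible operator on $\mathcal H$ and $M$ a bounded invertible operator on $\mathcal H\oplus\mathcal H$ with $M^TJM=J$; the symplectic eigenvalues of $S$ are the eigenvalues of $D$. For a bounded symmetric operator $A$ let $\lambda_j^\downarrow(A)$ be the supremum of the real $x$ such that $A$ has at least $j$ eigenvalues $\ge x$, and $\lambda_j^\uparrow(A)$ the infimum of the real $x$ such that $A$ has at least $j$ eigenvalues $\le x$, all counted with multiplicity. These are the $j$-th largest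 and the $j$-th smallest eigenvalue whenever these exist, and otherwise the point at which the remaining eigenvalues accumulate. Put $d_j^\downarrow(S)=\lambda_j^\downarrow(D)$ and $d_j^\uparrow(S)=\lambda_j^\uparrow(D)$. **Theorem.** Every Gaussian covariance operator $S$ on $\mathcal H\oplus\mathcal H$ has a Williamson form, and for every Williamson form of $S$ and every integer $j\ge1$ (with $j\le\dim\mathcal H$ if $\dim\mathcal H<\infty$), $$d_j^\downarrow(S)\le\lambda_j^\downarrow(S)\qquad\text{and}\qquad \lambda_j^\uparrow(S)\le d_j^\uparrow(S).$$ -/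

import Mathlib

noncomputable section

namespace GaussianCov

/-! ### Complexification of a real inner product space -/

/-- The complexification `E + i·E` of a real vector space `E`;
the pair `⟨x, y⟩` stands for `x + i·y`. -/
@[ext] structure Cplx (E : Type*) where
  /-- the real part -/
  re : E
  /-- the imaginary part -/
  im : E

namespace Cplx

/-- `E + i·E` is `E × E` as a set. -/
def equivProd (E : Type*) : Cplx E ≃ E × E where
  toFun z := (z.re, z.im)
  invFun p := ⟨p.1, p.2⟩
  left_inv _ := rfl
  right_inv _ := rfl

/-- Componentwise addition on `E + i·E`. -/
instance instAddCommGroup {E : Type*} [AddCommGroup E] : AddCommGroup (Cplx E) :=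
  (equivProd E).addCommGroup

/-- `(a + i b)(x + i y) = (a x - b y) + i (a y + b x)`. -/
instance instSMul {E : Type*} [AddCommGroup E] [Module ℝ E] : SMul ℂ (Cplx E) :=
  ⟨fun c z => ⟨c.re • z.re - c.im • z.im, c.re • z.im + c.im • z.re⟩⟩

@[simp] theorem add_re {E : Type*} [AddCommGroup E] (z w : Cplx E) :
    (z + w).re = z.re + w.re := rfl

@[simp] theorem add_im {E : Type*} [AddCommGroup E] (z w : Cplx E) :
    (z + w).im = z.im + w.im := rfl

@[simp] theorem zero_re {E : Type*} [AddCommGroup E] : (0 : Cplx E).re = 0 := rfl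

@[simp] theorem zero_im {E : Type*} [AddCommGroup E] : (0 : Cplx E).im = 0 := rfl

@[simp] theorem smul_re {E : Type*} [AddCommGroup E] [Module ℝ E] (c : ℂ) (z : Cplx E) :
    (c • z).re = c.re • z.re - c.im • z.im := rfl

@[simp] theorem smul_im {E : Type*} [AddCommGroup E] [Module ℝ E] (c : ℂ) (z : Cplx E) :
    (c • z).im = c.re • z.im + c.im • z.re := rfl

/-- `E + i·E` as a complex vector space. -/
instance instModule {E : Type*} [AddCommGroup E] [Module ℝ E] : Module ℂ (Cplx E) where
  one_smul z := by ext <;> simp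
  mul_smul c d z := by
    ext <;> simp only [smul_re, smul_im, Complex.mul_re, Complex.mul_im] <;> module
  smul_zero c := by ext <;> simp
  smul_add c z w := by
    ext <;> simp only [smul_re, smul_im, add_re, add_im] <;> module
  add_smul c d z := by
    ext <;> simp only [smul_re, smul_im, add_re, add_im, Complex.add_re, Complex.add_im] <;> module
  zero_smul z := by ext <;> simp

/-- The Hermitian inner product of `E + i·E` (conjugate linear in the first variable):
`⟪x + i y, u + i v⟫ = ⟪x, u⟫ + ⟪y, v⟫ + i (⟪x, v⟫ - ⟪y, u⟫)`. -/
@[reducible] def core (E : Type*) [NormedAddCommGroup E] [InnerProductSpace ℝ E] :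
    InnerProductSpace.Core ℂ (Cplx E) where
  inner z w := ⟨inner ℝ z.re w.re + inner ℝ z.im w.im, inner ℝ z.re w.im - inner ℝ z.im w.re⟩
  conj_inner_symm z w := by
    apply Complex.ext
    · simp [real_inner_comm]
    · simp [real_inner_comm]
  re_inner_nonneg z := by
    simpa using add_nonneg (real_inner_self_nonneg (x := z.re)) (real_inner_self_nonneg (x := z.im))
  add_left z w u := by
    apply Complex.ext
    · simp [inner_add_left]; ring
    · simp [inner_add_left]; ring
  smul_left z w c := by
    apply Complex.ext
    · simp [inner_add_left, inner_sub_left, real_inner_smul_left]; ring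
    · simp [inner_add_left, inner_sub_left, real_inner_smul_left]; ring
  definite z h := by
    have h1 : inner ℝ z.re z.re + inner ℝ z.im z.im = 0 := congrArg Complex.re h
    have h2 := real_inner_self_nonneg (x := z.re)
    have h3 := real_inner_self_nonneg (x := z.im)
    ext
    · exact inner_self_eq_zero.mp (le_antisymm (by linarith) h2)
    · exact inner_self_eq_zero.mp (le_antisymm (by linarith) h3)

/-- The norm of `E + i·E` given by its inner product. -/
instance instNormedAddCommGroup {E : Type*} [NormedAddCommGroup E] [InnerProductSpace ℝ E] :
    NormedAddCommGroup (Cplx E) :=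
  @InnerProductSpace.Core.toNormedAddCommGroup ℂ (Cplx E) _ _ _ (core E)

/-- `E + i·E` as a complex inner product space. -/
instance instInnerProductSpace {E : Type*} [NormedAddCommGroup E] [InnerProductSpace ℝ E] :
    InnerProductSpace ℂ (Cplx E) :=
  InnerProductSpace.ofCore (core E).toCore

/-- The complexification `Â(x + i y) = A x + i A y` of a real linear operator `A`. -/
def hat {E : Type*} [AddCommGroup E] [Module ℝ E] (A : E →ₗ[ℝ] E) :
    Cplx E →ₗ[ℂ] Cplx E where
  toFun z := ⟨A z.re, A z.im⟩
  map_add' z w := by ext <;> simp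
  map_smul' c z := by ext <;> simp

end Cplx

/-! ### Square roots, Hilbert-Schmidt and trace class operators on a real Hilbert space -/

/-- `R` is the (unique) positive square root `√A` of `A`. -/
def IsPosSqrt {K : Type*} [NormedAddCommGroup K] [InnerProductSpace ℝ K]
    (A R : K →L[ℝ] K) : Prop :=
  R.IsPositive ∧ R * R = A

/-- `A` is Hilbert-Schmidt: `∑ ‖A e‖² < ∞` over an orthonormal basis. -/
def IsHilbertSchmidt {K : Type*} [NormedAddCommGroup K] [InnerProductSpace ℝ K]
    [CompleteSpace K] (A : K →L[ℝ] K) : Prop :=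
  ∃ (w : Set K) (b : HilbertBasis w ℝ K), Summable fun e => ‖A (b e)‖ ^ 2

/-- `A` is of trace class: `∑ ⟪|A| e, e⟫ < ∞` over an orthonormal basis, where `|A| = √(Aᵀ A)`. -/
def IsTraceClass {K : Type*} [NormedAddCommGroup K] [InnerProductSpace ℝ K]
    [CompleteSpace K] (A : K →L[ℝ] K) : Prop :=
  ∃ P : K →L[ℝ] K, IsPosSqrt (A.adjoint * A) P ∧
    ∃ (w : Set K) (b : HilbertBasis w ℝ K), Summable fun e => inner ℝ (P (b e)) (b e)

/-! ### The symplectic structure of `H ⊕ H` -/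

/-- The Hilbert space direct sum `H ⊕ H`. -/
abbrev Dbl (H : Type*) : Type _ := WithLp 2 (H × H)

/-- The involution `J (x, y) = (y, -x)`, i.e. `J = [[0, I], [-I, 0]]`, of `H ⊕ H`. -/
def J (H : Type*) [NormedAddCommGroup H] [InnerProductSpace ℝ H] : Dbl H →L[ℝ] Dbl H :=
  ((WithLp.prodContinuousLinearEquiv 2 ℝ H H).symm : H × H →L[ℝ] Dbl H) ∘L
    ((ContinuousLinearMap.snd ℝ H H).prod (-ContinuousLinearMap.fst ℝ H H)) ∘L
    (WithLp.prodContinuousLinearEquiv 2 ℝ H H : Dbl H →L[ℝ] H × H)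

/-- The block diagonal operator `D ⊕ D = [[D, 0], [0, D]]` on `H ⊕ H`. -/
def diag {H : Type*} [NormedAddCommGroup H] [InnerProductSpace ℝ H] (D : H →L[ℝ] H) :
    Dbl H →L[ℝ] Dbl H :=
  ((WithLp.prodContinuousLinearEquiv 2 ℝ H H).symm : H × H →L[ℝ] Dbl H) ∘L
    (D.prodMap D) ∘L
    (WithLp.prodContinuousLinearEquiv 2 ℝ H H : Dbl H →L[ℝ] H × H)

/-- A symplectic transformation: a bounded invertible `M` with `Mᵀ J M = J`. -/
def IsSymplectic {H : Type*} [NormedAddCommGroup H] [InnerProductSpace ℝ H] [CompleteSpace H]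
    (M : Dbl H →L[ℝ] Dbl H) : Prop :=
  IsUnit M ∧ M.adjoint * J H * M = J H

/-- `D` is the diagonal part of a Williamson normal form of `A`: `D` is positive and invertible,
and `A = Mᵀ (D ⊕ D) M` for some symplectic transformation `M`. The symplectic eigenvalues of `A`
are the eigenvalues of such a `D`. -/
def IsWilliamson {H : Type*} [NormedAddCommGroup H] [InnerProductSpace ℝ H] [CompleteSpace H]
    (A : Dbl H →L[ℝ] Dbl H) (D : H →L[ℝ] H) : Prop :=
  D.IsPositive ∧ IsUnit D ∧
    ∃ M : Dbl H →L[ℝ] Dbl H, IsSymplectic M ∧ A = M.adjoint * diag D * M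

/-- Gaussian covariance operators on `H ⊕ H`. -/
structure IsGCO {H : Type*} [NormedAddCommGroup H] [InnerProductSpace ℝ H] [CompleteSpace H]
    (S : Dbl H →L[ℝ] Dbl H) : Prop where
  /-- `S` is symmetric -/
  symm : S.IsSymmetric
  /-- `S` has a bounded inverse -/
  inv : IsUnit S
  /-- `Ŝ - i Ĵ ≥ 0` on the complexification of `H ⊕ H` -/
  uncertainty : (Cplx.hat (S : Dbl H →ₗ[ℝ] Dbl H) -
    Complex.I • Cplx.hat (J H : Dbl H →ₗ[ℝ] Dbl H)).IsPositive
  /-- `S - I` is Hilbert-Schmidt -/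
  hilbertSchmidt : IsHilbertSchmidt (S - 1)
  /-- `(√S J √S)ᵀ (√S J √S) - I` is of trace class -/
  traceClass : ∃ R : Dbl H →L[ℝ] Dbl H, IsPosSqrt S R ∧
    IsTraceClass ((R * J H * R).adjoint * (R * J H * R) - 1)

/-! ### Eigenvalues in decreasing and in increasing order -/

/-- `A` has at least `j` eigenvalues in `I`, counted with multiplicity: there are `j` linearly
independent eigenvectors of `A` with eigenvalues in `I`. -/
def HasEigenvaluesIn {K : Type*} [NormedAddCommGroup K] [InnerProductSpace ℝ K]
    (A : K →L[ℝ] K) (j : ℕ) (I : Set ℝ) : Prop :=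
  ∃ v : Fin j → K, LinearIndependent ℝ v ∧ ∀ i, ∃ μ ∈ I, A (v i) = μ • v i

/-- `λ_j^↓(A)`, `j = 1, 2, …`: the supremum of all `x` such that `A` has at least `j` eigenvalues
`≥ x`, with multiplicity. If `A` has a `j`-th largest eigenvalue, the supremum is attained and is
that eigenvalue. Otherwise only fewer than `j` eigenvalues come first in decreasing order, and the
value is the point at which the others accumulate from below (the min-max convention). -/
def eigDown {K : Type*} [NormedAddCommGroup K] [InnerProductSpace ℝ K]
    (A : K →L[ℝ] K) (j : ℕ) : ℝ :=
  sSup {x | HasEigenvaluesIn A j (Set.Ici x)}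

/-- `λ_j^↑(A)`, `j = 1, 2, …`: the `j`-th eigenvalue of `A` in increasing order, with
multiplicity; if there is no `j`-th smallest eigenvalue, the point at which the remaining
eigenvalues accumulate from above. -/
def eigUp {K : Type*} [NormedAddCommGroup K] [InnerProductSpace ℝ K]
    (A : K →L[ℝ] K) (j : ℕ) : ℝ :=
  sInf {x | HasEigenvaluesIn A j (Set.Iic x)}

end GaussianCov

end

/-!
The existence of a Williamson form is a normal form theorem for the skew-symmetric operator
`B = √S J √S`. As `S - 1` is Hilbert-Schmidt, it is compact, and then so is `B² + 1`. A maximal set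
of orthonormal eigenvectors `e` of `B²` on which the form `⟪e, B f⟫` vanishes yields, together with
the normalized vectors `B e`, a Hilbert basis in which `B` consists of blocks
`d • [[0, -1], [1, 0]]` (`exists_hilbertBasis_skew`). So `O⁻¹ B O = J (D ⊕ D)` with `O` orthogonal
and `D` diagonal, and `M = (D ⊕ D)^{-1/2} O⁻¹ √S` is symplectic with `S = Mᵀ (D ⊕ D) M`
(`exists_isWilliamson`).

For the inequalities let `S = Mᵀ (D ⊕ D) M` be any Williamson form. On the complexification the
operator `√S (iJ) √S` has the positive eigenvalues of `D`, and `iJ ≤ 1` gives `√S (iJ) √S ≤ S`, so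
the bound for the largest eigenvalues is Weyl monotonicity; the one for the smallest eigenvalues is
the same statement for the inverses. The proof is carried out over the reals: a complex vector
becomes a pair `p = M⁻¹ z`, `q = M⁻¹ J z`, and `iJ ≤ 1` becomes `2 |⟪p, J q⟫| ≤ ‖p‖² + ‖q‖²`
(`two_mul_norm_sq_le`). If `D` has `j` eigenvalues in a half-line and `S` has fewer than `j` in a
slightly larger one, a dimension count (`exists_common_vector`) gives a vector `z` at which the two
bounds contradict each other (`IsWilliamson.hasEigenvaluesIn_Iic`,
`IsWilliamson.hasEigenvaluesIn_Ici`).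

Counting eigenvalues determines the suprema and infima because `S` and `D` have eigenbases: `S - 1`
is compact, and so is `D² - 1` since `-(J S)²` is similar to `D² ⊕ D²`
(`isCompactOperator_sq_sub_one`, `exists_eigenbasis_of_sq`).
-/

namespace GaussianCov

/-! ### Compact operators and diagonal operators -/

section Operators

variable {K : Type*} [NormedAddCommGroup K] [InnerProductSpace ℝ K]

/-- The tail of the expansion of `A x` along the basis is at most `‖x‖` times the `ℓ²`-tail of
`‖A (b e)‖`, so that `A` is a norm limit of finite rank operators. -/
theorem IsHilbertSchmidt.isCompactOperator [CompleteSpace K] {A : K →L[ℝ] K}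
    (hA : IsHilbertSchmidt A) : IsCompactOperator A := by
  classical
  obtain ⟨w, b, hs⟩ := hA
  let P : Finset w → K →L[ℝ] K := fun F => ∑ e ∈ F, (innerSL ℝ (b e)).smulRight (A (b e))
  have hP : ∀ F, IsCompactOperator (P F) := by
    intro F
    change P F ∈ compactOperator (RingHom.id ℝ) K K
    refine Submodule.sum_mem _ fun e _ => ?_
    change IsCompactOperator
      ((ContinuousLinearMap.toSpanSingleton ℝ (A (b e))) ∘ (innerSL ℝ (b e)))
    exact (isCompactOperator_id.clm_comp
      (ContinuousLinearMap.toSpanSingleton ℝ (A (b e)))).comp_clm (innerSL ℝ (b e))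
  have hcl := isClosed_setOfPred_isCompactOperator (σ₁₂ := RingHom.id ℝ) (M₁ := K) (M₂ := K)
  refine hcl.closure_subset_iff.2 (Set.Subset.refl _) (Metric.mem_closure_iff.2 fun ε hε => ?_)
  obtain ⟨F, hF⟩ := summable_iff_vanishing_norm.1 hs ((ε / 2) ^ 2) (by positivity)
  refine ⟨P F, hP F, ?_⟩
  rw [dist_eq_norm]
  refine lt_of_le_of_lt (ContinuousLinearMap.opNorm_le_bound _ (by positivity) fun x => ?_)
    (half_lt_self hε)
  have h1 : HasSum (fun e => inner ℝ (b e) x • A (b e)) (A x) := by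
    have := (b.hasSum_repr x).mapL A
    simpa [b.repr_apply_apply] using this
  refine le_of_tendsto ((Filter.Tendsto.sub_const h1 (P F x)).norm)
    (Filter.eventually_atTop.2 ⟨F, fun G hG => ?_⟩)
  have h2 : ∑ e ∈ G, inner ℝ (b e) x • A (b e) - P F x
      = ∑ e ∈ G \ F, inner ℝ (b e) x • A (b e) := by
    rw [Finset.sum_sdiff_eq_sub hG]
    simp [P]
  rw [h2]
  have h3 := (le_abs_self _).trans_lt (hF (G \ F) Finset.sdiff_disjoint)
  have h4 : ∑ e ∈ G \ F, ‖inner ℝ (b e) x‖ ^ 2 ≤ ‖x‖ ^ 2 :=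
    b.orthonormal.sum_inner_products_le x
  calc ‖∑ e ∈ G \ F, inner ℝ (b e) x • A (b e)‖
      ≤ ∑ e ∈ G \ F, ‖inner ℝ (b e) x‖ * ‖A (b e)‖ :=
        (norm_sum_le _ _).trans_eq (Finset.sum_congr rfl fun e _ => norm_smul _ _)
    _ ≤ ε / 2 * ‖x‖ := by
        refine abs_le_of_sq_le_sq' ?_ (by positivity) |>.2
        refine (Finset.sum_mul_sq_le_sq_mul_sq _ _ _).trans ?_
        rw [mul_pow, mul_comm]
        exact mul_le_mul h3.le h4 (Finset.sum_nonneg fun _ _ => by positivity) (by positivity)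

/-- A bounded operator is determined by its values on a Hilbert basis. -/
theorem ext_hilbertBasis {ι : Type*} (b : HilbertBasis ι ℝ K) {F : Type*} [NormedAddCommGroup F]
    [NormedSpace ℝ F] {A B : K →L[ℝ] F} (h : ∀ i, A (b i) = B (b i)) : A = B := by
  refine ContinuousLinearMap.ext_on (s := Set.range b) ?_ (by rintro _ ⟨i, rfl⟩; exact h i)
  have := b.dense_span
  rw [← Submodule.dense_iff_topologicalClosure_eq_top] at this
  exact this

/-- The spectral theorem for a compact symmetric perturbation of the identity. Hilbert bases of the
eigenspaces are put together; the eigenspace of the eigenvalue `1` may be infinite-dimensional. -/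
theorem exists_hilbertBasis_eigenvectors.{u} {K : Type u} [NormedAddCommGroup K]
    [InnerProductSpace ℝ K] [CompleteSpace K] {T : K →L[ℝ] K} (hT : T.IsSymmetric)
    (hc : IsCompactOperator ⇑(T - 1)) :
    ∃ (ι : Type u) (b : HilbertBasis ι ℝ K) (c : ι → ℝ), ∀ i, T (b i) = c i • b i := by
  have hT' : (T - 1).IsSymmetric := hT.sub LinearMap.IsSymmetric.one
  have hbot := ContinuousLinearMap.orthogonalComplement_iSup_eigenspaces_eq_bot hc hT'
  have hort := hT'.orthogonalFamily_eigenspaces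
  set E : ℝ → Submodule ℝ K := fun μ =>
    Module.End.eigenspace ((T - 1 : K →L[ℝ] K) : K →ₗ[ℝ] K) μ with hE
  have hcs : ∀ μ, CompleteSpace (E μ) := by
    intro μ
    have : IsClosed (E μ : Set K) := by
      have : (E μ : Set K) = {x | (T - 1) x = μ • x} := by
        ext x; simp [hE]
      rw [this]
      exact isClosed_eq (T - 1).continuous (continuous_const_smul μ)
    exact this.completeSpace_coe
  choose w f hf using fun μ => exists_hilbertBasis ℝ (E μ)
  let v : (Σ μ, w μ) → K := fun a => (f a.1 a.2 : E a.1)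
  have hv : Orthonormal ℝ v := hort.orthonormal_sigma_orthonormal fun μ => (f μ).orthonormal
  have hsp : (Submodule.span ℝ (Set.range v))ᗮ = ⊥ := by
    rw [eq_bot_iff, ← hbot, ← Submodule.iInf_orthogonal]
    intro x hx
    rw [Submodule.mem_iInf]
    intro μ y hy
    have h0 : (innerSL ℝ x) ∘L (E μ).subtypeL = 0 := by
      refine ext_hilbertBasis (f μ) fun i => ?_
      have := hx (v ⟨μ, i⟩) (Submodule.subset_span ⟨_, rfl⟩)
      rw [real_inner_comm] at this
      exact this
    rw [real_inner_comm]
    exact DFunLike.congr_fun h0 (⟨y, hy⟩ : E μ)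
  refine ⟨Σ μ, w μ, HilbertBasis.mkOfOrthogonalEqBot hv hsp, fun a => a.1 + 1, fun a => ?_⟩
  rw [HilbertBasis.coe_mkOfOrthogonalEqBot]
  have : (T - 1) (v a) = a.1 • v a := Module.End.mem_eigenspace_iff.1 (f a.1 a.2).2
  rw [add_smul, ← this]
  simp

/-- A bounded family of real numbers is the diagonal of a bounded symmetric operator. -/
theorem exists_diagonal [CompleteSpace K] {ι : Type*} (b : HilbertBasis ι ℝ K) (c : ι → ℝ) {C : ℝ}
    (hC : ∀ i, |c i| ≤ C) :
    ∃ A : K →L[ℝ] K, A.IsSymmetric ∧ ∀ i, A (b i) = c i • b i := by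
  classical
  let c' : lp (fun _ : ι => ℝ) ⊤ := ⟨c, memℓp_infty ⟨C, by rintro _ ⟨i, rfl⟩; exact hC i⟩⟩
  let m : lp (fun _ : ι => ℝ) 2 →L[ℝ] lp (fun _ : ι => ℝ) 2 :=
    lp.holderL 2 (fun _ => ContinuousLinearMap.mul ℝ ℝ) (K := 1) (fun _ => by simp) c'
  have hm : ∀ x i, m x i = c i * x i := fun x i => rfl
  let A : K →L[ℝ] K := (b.repr.symm : _ →L[ℝ] K) ∘L m ∘L (b.repr : K →L[ℝ] _)
  refine ⟨A, ?_, ?_⟩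
  · intro x y
    change inner ℝ (b.repr.symm (m (b.repr x))) y = inner ℝ x (b.repr.symm (m (b.repr y)))
    rw [← b.repr.inner_map_map, ← b.repr.inner_map_map x]
    simp only [LinearIsometryEquiv.apply_symm_apply, lp.inner_eq_tsum, hm]
    congr 1; ext i
    simp; ring
  · intro i
    change b.repr.symm (m (b.repr (b i))) = c i • b i
    rw [LinearIsometryEquiv.symm_apply_eq, map_smul, b.repr_self]
    ext k
    rw [hm]
    by_cases h : k = i
    · subst h; simp
    · simp [h]

end Operators

/-! ### Normal form of a skew-symmetric operator -/

/-- A set of orthonormal eigenvectors of `B²` each of which is orthogonal to the images under `B`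
of all of them. -/
structure IsIsotropicEigenset {K : Type*} [NormedAddCommGroup K] [InnerProductSpace ℝ K]
    (B : K →L[ℝ] K) (s : Set K) : Prop where
  norm_eq : ∀ e ∈ s, ‖e‖ = 1
  eigen : ∀ e ∈ s, ∃ μ : ℝ, B (B e) = μ • e
  orthogonal : ∀ e ∈ s, ∀ f ∈ s, e ≠ f → inner ℝ e f = 0
  isotropic : ∀ e ∈ s, ∀ f ∈ s, inner ℝ e (B f) = 0

/-- A nonzero closed subspace that is invariant under the skew-symmetric operator `B` contains a
unit eigenvector of `B²`, by the spectral theorem for the restriction of `B²`. -/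
theorem exists_eigenvector_of_invariant {K : Type*} [NormedAddCommGroup K] [InnerProductSpace ℝ K]
    [CompleteSpace K] {B : K →L[ℝ] K} (hB : ∀ x y, inner ℝ (B x) y = -inner ℝ x (B y))
    (hc : IsCompactOperator ⇑(B * B + 1)) (W : Submodule ℝ K) [CompleteSpace W] (hW : W ≠ ⊥)
    (hinv : ∀ x ∈ W, B x ∈ W) :
    ∃ e ∈ W, ‖e‖ = 1 ∧ ∃ μ : ℝ, B (B e) = μ • e := by
  have hinv2 : ∀ x ∈ W, (-(B * B)) x ∈ W := fun x hx => W.neg_mem (hinv _ (hinv _ hx))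
  have hinv3 : ∀ x ∈ W, (-(B * B + 1)) x ∈ W := fun x hx =>
    W.neg_mem (W.add_mem (hinv _ (hinv _ hx)) hx)
  let T : W →L[ℝ] W := (-(B * B)).restrict hinv2
  have hT : T.IsSymmetric := by
    intro x y
    change inner ℝ (-(B (B x))) (y : K) = inner ℝ (x : K) (-(B (B y)))
    rw [inner_neg_left, inner_neg_right, hB, hB, neg_neg]
  have hTc : IsCompactOperator ⇑(T - 1) := by
    have h1 : IsCompactOperator ((-(B * B + 1) : K →L[ℝ] K) : K →ₗ[ℝ] K) := hc.neg
    have h2 := h1.restrict' (V := W) hinv3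
    convert h2 using 1
    ext x
    change -(B (B x)) - (x : K) = -(B (B x) + x)
    abel
  obtain ⟨ι, b, c, hb⟩ := exists_hilbertBasis_eigenvectors hT hTc
  have hι : Nonempty ι := by
    by_contra h
    rw [not_nonempty_iff] at h
    have h0 : ContinuousLinearMap.id ℝ W = 0 := ext_hilbertBasis b fun i => h.elim i
    refine hW (Submodule.eq_bot_iff _ |>.2 fun x hx => ?_)
    exact congrArg Subtype.val (DFunLike.congr_fun h0 (⟨x, hx⟩ : W))
  obtain ⟨i⟩ := hι
  refine ⟨b i, (b i).2, b.orthonormal.1 i, -c i, ?_⟩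
  have := congrArg Subtype.val (hb i)
  change -(B (B (b i))) = c i • (b i : K) at this
  rw [neg_smul, ← this, neg_neg]

/-- An injective skew-symmetric operator whose square is a compact perturbation of `-1` is an
orthogonal direct sum of blocks `d • [[0, -1], [1, 0]]` with `d > 0`. The basis is built from a
maximal isotropic set of eigenvectors of `B²`. -/
theorem exists_hilbertBasis_skew {K : Type*} [NormedAddCommGroup K] [InnerProductSpace ℝ K]
    [CompleteSpace K] {B : K →L[ℝ] K} (hB : ∀ x y, inner ℝ (B x) y = -inner ℝ x (B y))
    (hinj : Function.Injective B) (hc : IsCompactOperator ⇑(B * B + 1)) :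
    ∃ (s : Set K) (b : HilbertBasis (s ⊕ s) ℝ K) (d : s → ℝ), (∀ e, 0 < d e) ∧
      ∀ e, B (b (Sum.inl e)) = d e • b (Sum.inr e) ∧
        B (b (Sum.inr e)) = -(d e • b (Sum.inl e)) := by
  obtain ⟨s, hs⟩ : ∃ s, Maximal (· ∈ {s | IsIsotropicEigenset B s}) s := by
    refine zorn_subset _ fun c hcs hch =>
      ⟨⋃₀ c, ⟨?_, ?_, ?_, ?_⟩, fun t ht => Set.subset_sUnion_of_mem ht⟩
    · rintro e ⟨t, ht, he⟩
      exact (hcs ht).norm_eq e he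
    · rintro e ⟨t, ht, he⟩
      exact (hcs ht).eigen e he
    · rintro e ⟨t, ht, he⟩ f ⟨u, hu, hf⟩ hef
      rcases hch.total ht hu with h | h
      · exact (hcs hu).orthogonal e (h he) f hf hef
      · exact (hcs ht).orthogonal e he f (h hf) hef
    · rintro e ⟨t, ht, he⟩ f ⟨u, hu, hf⟩
      rcases hch.total ht hu with h | h
      · exact (hcs hu).isotropic e (h he) f hf
      · exact (hcs ht).isotropic e he f (h hf)
  have hS : IsIsotropicEigenset B s := hs.1
  have hpos : ∀ e : s, 0 < ‖B e‖ := by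
    intro e
    refine norm_pos_iff.2 fun h => ?_
    have h0 : (e : K) = 0 := hinj (by rw [h, map_zero])
    have := hS.norm_eq e e.2
    rw [h0, norm_zero] at this
    exact zero_ne_one this
  have hBB : ∀ e : s, B (B e) = -(‖B e‖ ^ 2 • (e : K)) := by
    intro e
    obtain ⟨μ, hμ⟩ := hS.eigen e e.2
    have h1 : inner ℝ (B (B e)) (e : K) = -‖B e‖ ^ 2 := by
      rw [hB, real_inner_self_eq_norm_sq]
    rw [hμ, real_inner_smul_left, real_inner_self_eq_norm_sq, hS.norm_eq e e.2] at h1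
    rw [hμ, ← neg_smul]
    congr 1
    linarith
  have hBin : ∀ e f : K, inner ℝ (B e) (B f) = -inner ℝ (B (B e)) f := fun e f => by
    rw [hB (B e), neg_neg]
  let v : s ⊕ s → K := Sum.elim (fun e => (e : K)) (fun e => ‖B e‖⁻¹ • B e)
  have hv : Orthonormal ℝ v := by
    constructor
    · rintro (e | e)
      · exact hS.norm_eq e e.2
      · simp only [v, Sum.elim_inr, norm_smul, norm_inv, norm_norm]
        exact inv_mul_cancel₀ (hpos e).ne'
    · rintro (e | e) (f | f) hef
      · exact hS.orthogonal e e.2 f f.2 fun h => hef (by rw [Subtype.ext h])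
      · simp only [v, Sum.elim_inr, Sum.elim_inl, real_inner_smul_right,
          hS.isotropic e e.2 f f.2, mul_zero]
      · simp only [v, Sum.elim_inr, Sum.elim_inl, real_inner_smul_left]
        rw [real_inner_comm, hS.isotropic f f.2 e e.2, mul_zero]
      · simp only [v, Sum.elim_inr, real_inner_smul_left, real_inner_smul_right]
        rw [hBin, hBB, inner_neg_left, real_inner_smul_left,
          hS.orthogonal e e.2 f f.2 fun h => hef (by rw [Subtype.ext h])]
        simp
  have hmem : ∀ x, x ∈ (Submodule.span ℝ (Set.range v))ᗮ ↔
      ∀ e : s, inner ℝ (e : K) x = 0 ∧ inner ℝ (B e) x = 0 := by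
    intro x
    constructor
    · intro hx e
      refine ⟨hx _ (Submodule.subset_span ⟨Sum.inl e, rfl⟩), ?_⟩
      have := hx _ (Submodule.subset_span ⟨Sum.inr e, rfl⟩)
      simp only [v, Sum.elim_inr, real_inner_smul_left] at this
      exact (mul_eq_zero.1 this).resolve_left (inv_ne_zero (hpos e).ne')
    · intro hx
      rw [Submodule.mem_orthogonal']
      intro y hy
      rw [real_inner_comm]
      induction hy using Submodule.span_induction with
      | mem y hy =>
        obtain ⟨e | e, rfl⟩ := hy
        · exact (hx e).1
        · simp only [v, Sum.elim_inr, real_inner_smul_left, (hx e).2, mul_zero]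
      | zero => exact inner_zero_left _
      | add y z _ _ hy hz => rw [inner_add_left, hy, hz, add_zero]
      | smul a y _ hy => rw [real_inner_smul_left, hy, mul_zero]
  have hsp : (Submodule.span ℝ (Set.range v))ᗮ = ⊥ := by
    by_contra hW
    obtain ⟨e, heW, hen, μ, hμ⟩ := exists_eigenvector_of_invariant hB hc _ hW fun x hx => by
      rw [hmem] at hx ⊢
      intro e
      refine ⟨?_, ?_⟩
      · rw [← neg_neg (inner ℝ (e : K) (B x)), ← hB, (hx e).2, neg_zero]
      · rw [hBin, hBB, inner_neg_left, real_inner_smul_left, (hx e).1, mul_zero, neg_zero, neg_zero]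
    rw [hmem] at heW
    have hself : ∀ x, inner ℝ x (B x) = 0 := fun x => by
      have := hB x x
      rw [real_inner_comm] at this
      linarith
    have hins : IsIsotropicEigenset B (insert e s) := by
      refine ⟨?_, ?_, ?_, ?_⟩
      · rintro f (rfl | hf)
        exacts [hen, hS.norm_eq f hf]
      · rintro f (rfl | hf)
        exacts [⟨μ, hμ⟩, hS.eigen f hf]
      · rintro f (rfl | hf) g (rfl | hg) hfg
        · exact absurd rfl hfg
        · rw [real_inner_comm]; exact (heW ⟨g, hg⟩).1
        · exact (heW ⟨f, hf⟩).1
        · exact hS.orthogonal f hf g hg hfg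
      · rintro f (rfl | hf) g (rfl | hg)
        · exact hself _
        · rw [real_inner_comm]; exact (heW ⟨g, hg⟩).2
        · rw [← neg_neg (inner ℝ f (B g)), ← hB, (heW ⟨f, hf⟩).2, neg_zero]
        · exact hS.isotropic f hf g hg
    have hes : e ∈ s := hs.2 hins (Set.subset_insert e s) (Set.mem_insert e s)
    have h0 := (heW ⟨e, hes⟩).1
    rw [real_inner_self_eq_norm_sq, hen] at h0
    norm_num at h0
  refine ⟨s, HilbertBasis.mkOfOrthogonalEqBot hv hsp, fun e => ‖B e‖, hpos, fun e => ?_⟩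
  rw [HilbertBasis.coe_mkOfOrthogonalEqBot]
  refine ⟨?_, ?_⟩
  · simp only [v, Sum.elim_inl, Sum.elim_inr]
    rw [smul_inv_smul₀ (hpos e).ne']
  · simp only [v, Sum.elim_inl, Sum.elim_inr, map_smul]
    rw [hBB, smul_neg, smul_smul, pow_two, inv_mul_cancel_left₀ (hpos e).ne']

/-! ### Cardinality of Hilbert bases -/

/-- Balls of radius `1/2` around the vectors of an orthonormal family are disjoint. -/
theorem _root_.HilbertBasis.countable {K ι : Type*} [NormedAddCommGroup K] [InnerProductSpace ℝ K]
    [TopologicalSpace.SeparableSpace K] (b : HilbertBasis ι ℝ K) : Countable ι := by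
  have hd : Pairwise (Function.onFun Disjoint fun i => Metric.ball (b i) (1 / 2)) := by
    intro i j hij
    refine Metric.ball_disjoint_ball ?_
    rw [dist_eq_norm, add_halves, ← abs_of_nonneg (norm_nonneg (b i - b j)),
      ← one_le_sq_iff_one_le_abs, @norm_sub_sq ℝ, b.orthonormal.1 i, b.orthonormal.1 j,
      b.orthonormal.2 hij]
    norm_num
  exact hd.countable_of_isOpen_disjoint (fun i => Metric.isOpen_ball)
    fun i => ⟨b i, Metric.mem_ball_self (by norm_num)⟩

theorem _root_.HilbertBasis.finite_iff {K ι : Type*} [NormedAddCommGroup K] [InnerProductSpace ℝ K]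
    (b : HilbertBasis ι ℝ K) : Finite ι ↔ FiniteDimensional ℝ K := by
  constructor
  · intro h
    have := Fintype.ofFinite ι
    exact b.toOrthonormalBasis.toBasis.finiteDimensional_of_finite
  · intro h
    exact b.orthonormal.linearIndependent.finite

theorem _root_.HilbertBasis.natCard_eq_finrank {K ι : Type*} [NormedAddCommGroup K]
    [InnerProductSpace ℝ K] [Finite ι] (b : HilbertBasis ι ℝ K) :
    Nat.card ι = Module.finrank ℝ K := by
  have := Fintype.ofFinite ι
  exact (Module.finrank_eq_nat_card_basis b.toOrthonormalBasis.toBasis).symm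

/-- If `H ⊕ H` has a Hilbert basis indexed by `ι ⊕ ι`, then `H` has one indexed by `ι`. -/
theorem exists_hilbertBasis_of_sum {H ι : Type*} [NormedAddCommGroup H] [InnerProductSpace ℝ H]
    [CompleteSpace H] [TopologicalSpace.SeparableSpace H] (b : HilbertBasis (ι ⊕ ι) ℝ (Dbl H)) :
    Nonempty (HilbertBasis ι ℝ H) := by
  obtain ⟨w, h, -⟩ := exists_hilbertBasis ℝ H
  suffices hne : Nonempty (ι ≃ w) by
    obtain ⟨σ⟩ := hne
    refine ⟨HilbertBasis.mk (h.orthonormal.comp σ σ.injective) ?_⟩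
    rw [σ.surjective.range_comp, h.dense_span]
  have hfd : FiniteDimensional ℝ (Dbl H) ↔ FiniteDimensional ℝ H := by
    constructor
    · intro _
      refine Module.Finite.of_surjective (WithLp.fstL 2 ℝ H H : Dbl H →ₗ[ℝ] H) fun x =>
        ⟨WithLp.toLp 2 (x, 0), rfl⟩
    · intro _
      exact Module.Finite.equiv (WithLp.linearEquiv 2 ℝ (H × H)).symm
  by_cases hf : FiniteDimensional ℝ H
  · have h1 : Finite w := h.finite_iff.2 hf
    have h2 : Finite (ι ⊕ ι) := b.finite_iff.2 (hfd.2 hf)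
    have h3 : Finite ι := Finite.of_injective (Sum.inl : ι → ι ⊕ ι) Sum.inl_injective
    have h4 := b.natCard_eq_finrank
    have h5 := h.natCard_eq_finrank
    rw [(WithLp.linearEquiv 2 ℝ (H × H)).finrank_eq, Module.finrank_prod, Nat.card_sum] at h4
    exact Finite.card_eq.1 (by omega)
  · have h1 : Infinite w := not_finite_iff_infinite.1 fun h' => hf (h.finite_iff.1 h')
    have h2 : Infinite ι := by
      refine not_finite_iff_infinite.1 fun h' => hf (hfd.1 (b.finite_iff.1 ?_))
      infer_instance
    have : Countable w := h.countable
    have : TopologicalSpace.SeparableSpace (Dbl H) :=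
      (WithLp.prodContinuousLinearEquiv 2 ℝ H H).symm.surjective.denseRange.separableSpace
        (WithLp.prodContinuousLinearEquiv 2 ℝ H H).symm.continuous
    have : Countable (ι ⊕ ι) := b.countable
    have : Countable ι := (Sum.inl_injective : Function.Injective (Sum.inl : ι → ι ⊕ ι)).countable
    exact nonempty_equiv_of_countable

/-! ### Symplectic algebra on `H ⊕ H` -/

section Symplectic

variable {H : Type*} [NormedAddCommGroup H] [InnerProductSpace ℝ H]

@[simp] theorem J_apply_fst (z : Dbl H) : (J H z).fst = z.snd := rfl

@[simp] theorem J_apply_snd (z : Dbl H) : (J H z).snd = -z.fst := rfl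

@[simp] theorem diag_apply_fst (D : H →L[ℝ] H) (z : Dbl H) : (diag D z).fst = D z.fst := rfl

@[simp] theorem diag_apply_snd (D : H →L[ℝ] H) (z : Dbl H) : (diag D z).snd = D z.snd := rfl

theorem dbl_ext {H : Type*} {z w : Dbl H} (h1 : z.fst = w.fst) (h2 : z.snd = w.snd) : z = w :=
  WithLp.ofLp_injective 2 (Prod.ext h1 h2)

theorem inner_dbl (z w : Dbl H) : inner ℝ z w = inner ℝ z.fst w.fst + inner ℝ z.snd w.snd := rfl

/-- `neg_mul` on `H ⊕ H`, where unification does not see through the instance of `Neg`. -/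
theorem dbl_neg_mul (A B : Dbl H →L[ℝ] Dbl H) : -A * B = -(A * B) := neg_mul A B

/-- `mul_neg` on `H ⊕ H`, where unification does not see through the instance of `Neg`. -/
theorem dbl_mul_neg (A B : Dbl H →L[ℝ] Dbl H) : A * -B = -(A * B) := mul_neg A B

theorem J_mul_J : J H * J H = -1 := by
  ext z
  refine dbl_ext ?_ ?_
  · change -z.fst = (-z).fst
    rfl
  · change -z.snd = (-z).snd
    rfl

theorem J_mul_J_mul (A : Dbl H →L[ℝ] Dbl H) : J H * (J H * A) = -A := by
  rw [← mul_assoc, J_mul_J, dbl_neg_mul, one_mul]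

theorem isUnit_J : IsUnit (J H) :=
  ⟨⟨J H, -J H, by rw [dbl_mul_neg, J_mul_J, neg_neg], by rw [dbl_neg_mul, J_mul_J, neg_neg]⟩, rfl⟩

theorem inner_J_left (z w : Dbl H) : inner ℝ (J H z) w = -inner ℝ z (J H w) := by
  simp only [inner_dbl, J_apply_fst, J_apply_snd, inner_neg_left, inner_neg_right]
  ring

theorem J_J_apply (z : Dbl H) : J H (J H z) = -z := DFunLike.congr_fun J_mul_J z

theorem norm_J_apply (z : Dbl H) : ‖J H z‖ = ‖z‖ := by
  rw [← sq_eq_sq₀ (norm_nonneg _) (norm_nonneg _), ← real_inner_self_eq_norm_sq, inner_J_left,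
    J_J_apply, inner_neg_right, neg_neg, real_inner_self_eq_norm_sq]

theorem diag_mul (A B : H →L[ℝ] H) : diag (A * B) = diag A * diag B := rfl

theorem diag_one : diag (1 : H →L[ℝ] H) = 1 := rfl

theorem diag_mul_J (A : H →L[ℝ] H) : diag A * J H = J H * diag A := by
  ext z
  refine dbl_ext rfl ?_
  change A (-z.fst) = -A z.fst
  rw [map_neg]

/-- With `B = √S J √S`, this is `B² + 1` expressed through the compact operator `S - 1`. -/
theorem isCompactOperator_sq_add_one {R S : Dbl H →L[ℝ] Dbl H} (hR : R * R = S)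
    (hS : IsCompactOperator ⇑(S - 1)) :
    IsCompactOperator ⇑(R * J H * R * (R * J H * R) + 1) := by
  have h : R * J H * R * (R * J H * R) + 1 = R * J H * (S - 1) * (J H * R) - (S - 1) := by
    rw [← hR]
    simp only [mul_sub, sub_mul, mul_assoc, mul_one, J_mul_J_mul, dbl_mul_neg]
    abel
  rw [h]
  exact ((hS.clm_comp (R * J H)).comp_clm (J H * R)).sub hS

variable [CompleteSpace H]

theorem adjoint_diag {A : H →L[ℝ] H} (hA : A.IsSymmetric) : (diag A).adjoint = diag A := by
  refine ((ContinuousLinearMap.eq_adjoint_iff _ _).2 fun z w => ?_).symm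
  simp only [inner_dbl, diag_apply_fst, diag_apply_snd]
  exact congrArg₂ (· + ·) (hA _ _) (hA _ _)

theorem isSymplectic_iff {M : Dbl H →L[ℝ] Dbl H} (hM : IsUnit M) :
    IsSymplectic M ↔ M * J H * M.adjoint = J H := by
  -- `Mᵀ J M = J` says that `-J Mᵀ J` is a left inverse of `M`, `M J Mᵀ = J` that it is a right one.
  obtain ⟨u, rfl⟩ := hM
  have key : ∀ N : Dbl H →L[ℝ] Dbl H, N * u = 1 ↔ u * N = 1 := fun N => by
    rw [Units.mul_eq_one_iff_eq_inv, Units.mul_eq_one_iff_inv_eq, eq_comm]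
  have h := key (-(J H * (u : Dbl H →L[ℝ] Dbl H).adjoint * J H))
  constructor
  · rintro ⟨-, h1⟩
    have h2 := h.1 (by
      rw [dbl_neg_mul, mul_assoc, mul_assoc, ← mul_assoc _ (J H), h1, J_mul_J, neg_neg])
    calc _ = (u : Dbl H →L[ℝ] Dbl H) * -(J H * (u : Dbl H →L[ℝ] Dbl H).adjoint * J H) * J H := by
            simp only [dbl_mul_neg, dbl_neg_mul, mul_assoc, J_mul_J, mul_one, neg_neg]
      _ = J H := by rw [h2, one_mul]
  · intro h1
    refine ⟨u.isUnit, ?_⟩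
    have h2 := h.2 (by
      rw [dbl_mul_neg, ← mul_assoc, ← mul_assoc, h1, J_mul_J, neg_neg])
    calc _ = J H * (-(J H * (u : Dbl H →L[ℝ] Dbl H).adjoint * J H) * u) := by
            simp only [dbl_mul_neg, dbl_neg_mul, mul_assoc, J_mul_J_mul, neg_neg]
      _ = J H := by rw [h2, mul_one]

/-- The Hilbert basis of `H ⊕ H` made of the vectors `(0, h i)` and `(h i, 0)`. The second summand
comes first because `J` maps `(0, x)` to `(x, 0)`. -/
theorem exists_hilbertBasis_dbl {ι : Type*} (h : HilbertBasis ι ℝ H) :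
    ∃ g : HilbertBasis (ι ⊕ ι) ℝ (Dbl H), ∀ i, g (Sum.inl i) = WithLp.toLp 2 (0, h i) ∧
      g (Sum.inr i) = WithLp.toLp 2 (h i, 0) := by
  let v : ι ⊕ ι → Dbl H :=
    Sum.elim (fun i => WithLp.toLp 2 (0, h i)) fun i => WithLp.toLp 2 (h i, 0)
  have hz : ∀ x : H, (∀ i, inner ℝ (h i) x = 0) → x = 0 := fun x hx => by
    have h0 : innerSL ℝ x = 0 := ext_hilbertBasis h fun i => by
      rw [innerSL_apply_apply, real_inner_comm, hx]; rfl
    exact inner_self_eq_zero.1 (DFunLike.congr_fun h0 x)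
  have hv : Orthonormal ℝ v := by
    classical
    have ho := orthonormal_iff_ite.1 h.orthonormal
    rw [orthonormal_iff_ite]
    rintro (i | i) (k | k) <;> simp [v, ho]
  have hsp : (Submodule.span ℝ (Set.range v))ᗮ = ⊥ := by
    refine (Submodule.eq_bot_iff _).2 fun z hz' => ?_
    refine dbl_ext (hz _ fun i => ?_) (hz _ fun i => ?_)
    · simpa [v, inner_dbl] using hz' (v (Sum.inr i)) (Submodule.subset_span ⟨_, rfl⟩)
    · simpa [v, inner_dbl] using hz' (v (Sum.inl i)) (Submodule.subset_span ⟨_, rfl⟩)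
  refine ⟨HilbertBasis.mkOfOrthogonalEqBot hv hsp, fun i => ?_⟩
  rw [HilbertBasis.coe_mkOfOrthogonalEqBot]
  exact ⟨rfl, rfl⟩

/-- Williamson's normal form. The skew-symmetric operator `√S J √S` is orthogonally equivalent to
`J (D ⊕ D)`, say through `O`, and `M = (D ⊕ D)^{-1/2} O⁻¹ √S` is symplectic. -/
theorem exists_isWilliamson [TopologicalSpace.SeparableSpace H] {R S : Dbl H →L[ℝ] Dbl H}
    (hR : IsPosSqrt S R) (hS : IsUnit S) (hc : IsCompactOperator ⇑(S - 1)) :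
    ∃ D : H →L[ℝ] H, IsWilliamson S D := by
  obtain ⟨hRp, hRS⟩ := hR
  have hRsymm := hRp.isSymmetric
  have hRu : IsUnit R := by
    rw [← hRS] at hS
    exact ((Commute.refl R).isUnit_mul_iff.1 hS).1
  set B : Dbl H →L[ℝ] Dbl H := R * J H * R with hBdef
  have hBu : IsUnit B := (hRu.mul isUnit_J).mul hRu
  obtain ⟨B', hB'⟩ := hBu.exists_left_inv
  have hBskew : ∀ x y, inner ℝ (B x) y = -inner ℝ x (B y) := fun x y => by
    have h1 : inner ℝ (B x) y = inner ℝ (J H (R x)) (R y) := hRsymm _ _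
    have h2 : inner ℝ x (B y) = inner ℝ (R x) (J H (R y)) := (hRsymm _ _).symm
    rw [h1, h2, inner_J_left]
  have hB'apply : ∀ x, B' (B x) = x := fun x => DFunLike.congr_fun hB' x
  obtain ⟨s, b, d, hd, hb⟩ := exists_hilbertBasis_skew hBskew
    (Function.LeftInverse.injective hB'apply) (isCompactOperator_sq_add_one hRS hc)
  obtain ⟨h⟩ := exists_hilbertBasis_of_sum b
  obtain ⟨g, hg⟩ := exists_hilbertBasis_dbl h
  have hdn : ∀ e, ‖B (b (Sum.inl e))‖ = d e := fun e => by
    rw [(hb e).1, norm_smul, b.orthonormal.1, mul_one, Real.norm_of_nonneg (hd e).le]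
  have hdle : ∀ e, d e ≤ ‖B‖ := fun e => by
    rw [← hdn]
    simpa [b.orthonormal.1] using B.le_opNorm (b (Sum.inl e))
  have hdinv : ∀ e, (d e)⁻¹ ≤ ‖B'‖ := fun e => by
    rw [inv_le_iff_one_le_mul₀ (hd e), ← hdn, ← b.orthonormal.1 (Sum.inl e)]
    conv_lhs => rw [← hB'apply (b (Sum.inl e))]
    exact B'.le_opNorm _
  obtain ⟨E, hEs, hE⟩ := exists_diagonal h (fun e => √(d e)) (C := √‖B‖) fun e => by
    rw [abs_of_nonneg (Real.sqrt_nonneg _)]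
    exact Real.sqrt_le_sqrt (hdle e)
  obtain ⟨F, hFs, hF⟩ := exists_diagonal h (fun e => (√(d e))⁻¹) (C := √‖B'‖) fun e => by
    rw [← Real.sqrt_inv, abs_of_nonneg (Real.sqrt_nonneg _)]
    exact Real.sqrt_le_sqrt (hdinv e)
  have hd' : ∀ e, √(d e) ≠ 0 := fun e => (Real.sqrt_pos.2 (hd e)).ne'
  have hEF : E * F = 1 := ext_hilbertBasis h fun e => by
    change E (F (h e)) = h e
    rw [hF, map_smul, hE, inv_smul_smul₀ (hd' e)]
  have hFE : F * E = 1 := ext_hilbertBasis h fun e => by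
    change F (E (h e)) = h e
    rw [hE, map_smul, hF, smul_inv_smul₀ (hd' e)]
  have hD : ∀ e, (E * E) (h e) = d e • h e := fun e => by
    change E (E (h e)) = _
    rw [hE, map_smul, hE, smul_smul, Real.mul_self_sqrt (hd e).le]
  have hEu : IsUnit E := ⟨⟨E, F, hEF, hFE⟩, rfl⟩
  have hFu : IsUnit (diag F) :=
    ⟨⟨diag F, diag E, by rw [← diag_mul, hFE, diag_one], by rw [← diag_mul, hEF, diag_one]⟩, rfl⟩
  let U : Dbl H ≃ₗᵢ[ℝ] Dbl H := g.repr.trans b.repr.symm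
  have hU : ∀ k, U (g k) = b k := fun k => by
    classical
    simp only [U, LinearIsometryEquiv.trans_apply, HilbertBasis.repr_self,
      HilbertBasis.repr_symm_single]
  let O : Dbl H →L[ℝ] Dbl H := U
  let O' : Dbl H →L[ℝ] Dbl H := U.symm
  have hOO' : O * O' = 1 := ContinuousLinearMap.ext fun x => U.apply_symm_apply x
  have hO'O : O' * O = 1 := ContinuousLinearMap.ext fun x => U.symm_apply_apply x
  have hOu : IsUnit O' := ⟨⟨O', O, hO'O, hOO'⟩, rfl⟩
  have hOadj : O'.adjoint = O := by
    refine ((ContinuousLinearMap.eq_adjoint_iff _ _).2 fun x y => ?_).symm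
    change inner ℝ (U x) y = inner ℝ x (U.symm y)
    rw [← U.symm.inner_map_map, U.symm_apply_apply]
  have hkey : O' * B * O = J H * diag (E * E) := by
    have hO' : ∀ k, O' (b k) = g k := fun k => by
      rw [← hU]; exact U.symm_apply_apply _
    refine ext_hilbertBasis g ?_
    rintro (e | e)
    · change O' (B (U (g (Sum.inl e)))) = J H (diag (E * E) (g (Sum.inl e)))
      rw [hU, (hb e).1, map_smul, hO', (hg e).1, (hg e).2]
      refine dbl_ext ?_ ?_
      · change d e • h e = (E * E) (h e)
        rw [hD]
      · change d e • (0 : H) = -(E * E) 0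
        rw [map_zero, smul_zero, neg_zero]
    · change O' (B (U (g (Sum.inr e)))) = J H (diag (E * E) (g (Sum.inr e)))
      rw [hU, (hb e).2, map_neg, map_smul, hO', (hg e).1, (hg e).2]
      refine dbl_ext ?_ ?_
      · change -(d e • (0 : H)) = (E * E) 0
        rw [map_zero, smul_zero, neg_zero]
      · change -(d e • h e) = -(E * E) (h e)
        rw [hD]
  have hMadj : (diag F * O' * R).adjoint = R * O * diag F := by
    change ((diag F ∘L O') ∘L R).adjoint = _
    rw [ContinuousLinearMap.adjoint_comp, ContinuousLinearMap.adjoint_comp, adjoint_diag hFs, hOadj,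
      hRp.isSelfAdjoint.adjoint_eq]
    rfl
  refine ⟨E * E, ?_, hEu.mul hEu, diag F * O' * R, ?_, ?_⟩
  · refine (ContinuousLinearMap.isPositive_iff _).2 ⟨fun x y => ?_, fun x => ?_⟩
    · change inner ℝ (E (E x)) y = inner ℝ x (E (E y))
      exact (hEs _ _).trans (hEs _ _)
    · change 0 ≤ inner ℝ (E (E x)) x
      have h1 : inner ℝ (E (E x)) x = inner ℝ (E x) (E x) := hEs _ _
      rw [h1]
      exact real_inner_self_nonneg
  · rw [isSymplectic_iff ((hFu.mul hOu).mul hRu), hMadj]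
    calc diag F * O' * R * J H * (R * O * diag F) = diag F * (O' * B * O) * diag F := by
          simp only [hBdef, mul_assoc]
      _ = J H * diag (F * (E * E) * F) := by
          rw [hkey, diag_mul (F * (E * E)) F, diag_mul F (E * E), ← mul_assoc, diag_mul_J]
          simp only [mul_assoc]
      _ = J H := by
          rw [← mul_assoc F, hFE, one_mul, hEF, diag_one, mul_one]
  · rw [hMadj]
    calc S = R * R := hRS.symm
      _ = R * (O * diag (F * (E * E) * F) * O') * R := by
          rw [← mul_assoc F, hFE, one_mul, hEF, diag_one, mul_one, hOO', mul_one]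
      _ = R * O * diag F * diag (E * E) * (diag F * O' * R) := by
          rw [diag_mul, diag_mul]
          simp only [mul_assoc]

end Symplectic

/-! ### Counting eigenvalues in an eigenbasis -/

section Counting

variable {K : Type*} [NormedAddCommGroup K] [InnerProductSpace ℝ K]
  {ι : Type*} {b : HilbertBasis ι ℝ K} {A : K →L[ℝ] K} {c : ι → ℝ}

/-- A quadratic polynomial that is nonnegative at all eigenvalues occurring in the expansion of `p`
is nonnegative at `A`, evaluated at `p`. -/
theorem quadratic_nonneg (hA : A.IsSymmetric) (hb : ∀ i, A (b i) = c i • b i) {p : K} {α β γ : ℝ}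
    (h : ∀ i, inner ℝ (b i) p ≠ 0 → 0 ≤ α + β * c i + γ * c i ^ 2) :
    0 ≤ α * ‖p‖ ^ 2 + β * inner ℝ p (A p) + γ * ‖A p‖ ^ 2 := by
  have hAp : ∀ i, inner ℝ (b i) (A p) = c i * inner ℝ (b i) p := fun i => by
    have h1 : inner ℝ (A (b i)) p = inner ℝ (b i) (A p) := hA _ _
    rw [← h1, hb, real_inner_smul_left]
  have h0 := (b.hasSum_inner_mul_inner p p).mul_left α
  have h1 := (b.hasSum_inner_mul_inner p (A p)).mul_left β
  have h2 := (b.hasSum_inner_mul_inner (A p) (A p)).mul_left γ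
  rw [real_inner_self_eq_norm_sq] at h0 h2
  refine ((h0.add h1).add h2).nonneg fun i => ?_
  rw [real_inner_comm (b i) p, real_inner_comm (b i) (A p), hAp]
  by_cases hi : inner ℝ (b i) p = 0
  · simp [hi]
  · have := mul_nonneg (h i hi) (sq_nonneg (inner ℝ (b i) p))
    linarith

theorem finite_of_not_hasEigenvaluesIn (hb : ∀ i, A (b i) = c i • b i) {j : ℕ} {I : Set ℝ}
    (h : ¬HasEigenvaluesIn A j I) : {i | c i ∈ I}.Finite ∧ {i | c i ∈ I}.ncard < j := by
  have key : ¬((j : ℕ∞) ≤ {i | c i ∈ I}.encard) := by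
    intro hle
    obtain ⟨t, ht, htj⟩ := Set.exists_subset_encard_eq hle
    have htf : t.Finite := Set.finite_of_encard_eq_coe htj
    have : Finite t := htf
    have hcard : Nat.card t = j := by
      rw [Nat.card_coe_set_eq, Set.ncard, htj, ENat.toNat_natCast]
    let σ : Fin j ≃ t := (Finite.equivFinOfCardEq hcard).symm
    exact h ⟨fun k => b (σ k), b.orthonormal.linearIndependent.comp (fun k => (σ k : ι))
      (Subtype.val_injective.comp σ.injective), fun k => ⟨c (σ k), ht (σ k).2, hb _⟩⟩
  rw [not_le] at key
  have hf : {i | c i ∈ I}.Finite := Set.encard_lt_top_iff.1 (key.trans (ENat.natCast_lt_top j))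
  refine ⟨hf, ?_⟩
  rwa [← hf.cast_ncard_eq, Nat.cast_lt] at key

theorem hasEigenvaluesIn_of_le_rank (hb : ∀ i, A (b i) = c i • b i) {j : ℕ}
    (hj : (j : Cardinal) ≤ Module.rank ℝ K) {I : Set ℝ} (hI : ∀ i, c i ∈ I) :
    HasEigenvaluesIn A j I := by
  by_contra h
  obtain ⟨h1, h2⟩ := finite_of_not_hasEigenvaluesIn hb h
  have hu : {i | c i ∈ I} = Set.univ := Set.eq_univ_of_forall hI
  rw [hu] at h1 h2
  have : Finite ι := Set.finite_univ_iff.1 h1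
  have : FiniteDimensional ℝ K := b.finite_iff.1 this
  rw [Set.ncard_univ, b.natCard_eq_finrank] at h2
  rw [← Module.finrank_eq_rank, Nat.cast_le] at hj
  omega

/-- The span of eigenvectors of `A` with eigenvalues in `I` only involves the basis vectors with
eigenvalues in `I`. -/
theorem mem_of_mem_span_eigenvectors (hA : A.IsSymmetric) (hb : ∀ i, A (b i) = c i • b i)
    {κ : Type*} {v : κ → K} {I : Set ℝ} (hv : ∀ k, ∃ μ ∈ I, A (v k) = μ • v k) {p : K}
    (hp : p ∈ Submodule.span ℝ (Set.range v)) {i : ι} (hi : inner ℝ (b i) p ≠ 0) : c i ∈ I := by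
  by_contra hc
  refine hi ?_
  clear hi
  induction hp using Submodule.span_induction with
  | mem x hx =>
    obtain ⟨k, rfl⟩ := hx
    obtain ⟨μ, hμ, hk⟩ := hv k
    have h1 : inner ℝ (A (b i)) (v k) = inner ℝ (b i) (A (v k)) := hA _ _
    rw [hb, hk, real_inner_smul_left, real_inner_smul_right] at h1
    have h2 : (c i - μ) * inner ℝ (b i) (v k) = 0 := by linarith
    refine (mul_eq_zero.1 h2).resolve_left fun h3 => hc ?_
    rwa [sub_eq_zero.1 h3]
  | zero => exact inner_zero_right _
  | add x y _ _ hx hy => rw [inner_add_right, hx, hy, add_zero]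
  | smul a x _ hx => rw [real_inner_smul_right, hx, mul_zero]

theorem eigenvalue_nonneg (hA : A.IsPositive) {v : K} (hv : v ≠ 0) {μ : ℝ} (h : A v = μ • v) :
    0 ≤ μ := by
  have h1 := hA.inner_nonneg_right v
  rw [h, real_inner_smul_right, real_inner_self_eq_norm_sq] at h1
  exact nonneg_of_mul_nonneg_left h1 (by positivity)

theorem eigenvalue_le_norm {v : K} (hv : v ≠ 0) {μ : ℝ} (h : A v = μ • v) : μ ≤ ‖A‖ := by
  have h1 := A.le_opNorm v
  rw [h, norm_smul] at h1
  exact (le_abs_self μ).trans (le_of_mul_le_mul_right h1 (norm_pos_iff.2 hv))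

theorem bddAbove_hasEigenvaluesIn (A : K →L[ℝ] K) {j : ℕ} (hj : 1 ≤ j) :
    BddAbove {x | HasEigenvaluesIn A j (Set.Ici x)} := by
  refine ⟨‖A‖, ?_⟩
  rintro x ⟨v, hv, h⟩
  obtain ⟨μ, hμ, hk⟩ := h ⟨0, hj⟩
  exact (Set.mem_Ici.1 hμ).trans (eigenvalue_le_norm (hv.ne_zero _) hk)

theorem nonneg_of_hasEigenvaluesIn_Iic (hA : A.IsPositive) {j : ℕ} (hj : 1 ≤ j) {x : ℝ}
    (h : HasEigenvaluesIn A j (Set.Iic x)) : 0 ≤ x := by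
  obtain ⟨v, hv, h⟩ := h
  obtain ⟨μ, hμ, hk⟩ := h ⟨0, hj⟩
  exact (eigenvalue_nonneg hA (hv.ne_zero _) hk).trans hμ

end Counting

/-! ### The operator `D` of a Williamson form -/

section Williamson

variable {H : Type*} [NormedAddCommGroup H] [InnerProductSpace ℝ H]

/-- If `D` has `j` eigenvalues in `I` and `S` has fewer than `j` in `I'`, a dimension count gives
`z ≠ 0` in the eigenspaces of `D ⊕ D` for `I` such that `N z` and `N (J z)` have no components in
the eigenspaces of `S` for `I'`: there are `2 j` parameters and fewer than `2 j` conditions. The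
pair `z`, `J z` plays the role of a vector of the complexification. -/
theorem exists_common_vector {D : H →L[ℝ] H} {S : Dbl H →L[ℝ] Dbl H} (N : Dbl H →L[ℝ] Dbl H)
    (hD : D.IsSymmetric) {ι ι' : Type*} {h : HilbertBasis ι ℝ H} {c : ι → ℝ}
    (hh : ∀ i, D (h i) = c i • h i) {b : HilbertBasis ι' ℝ (Dbl H)} {c' : ι' → ℝ}
    (hb : ∀ i, S (b i) = c' i • b i) {j : ℕ} {I I' : Set ℝ} (hDI : HasEigenvaluesIn D j I)
    (hSI : ¬HasEigenvaluesIn S j I') :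
    ∃ z : Dbl H, z ≠ 0 ∧ (∀ i, inner ℝ (h i) z.fst ≠ 0 → c i ∈ I) ∧
      (∀ i, inner ℝ (h i) z.snd ≠ 0 → c i ∈ I) ∧
      (∀ i, inner ℝ (b i) (N z) ≠ 0 → c' i ∉ I') ∧
      ∀ i, inner ℝ (b i) (N (J H z)) ≠ 0 → c' i ∉ I' := by
  obtain ⟨v, hv, hvI⟩ := hDI
  obtain ⟨hf, hcard⟩ := finite_of_not_hasEigenvaluesIn hb hSI
  set F := {i | c' i ∈ I'}
  have : Fintype F := hf.fintype
  set V := Submodule.span ℝ (Set.range v)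
  have hV : Module.finrank ℝ V = j := by
    rw [finrank_span_eq_card hv, Fintype.card_fin]
  have : FiniteDimensional ℝ V := FiniteDimensional.span_of_finite ℝ (Set.finite_range v)
  let e : V × V →ₗ[ℝ] Dbl H :=
    (WithLp.linearEquiv 2 ℝ (H × H)).symm.toLinearMap ∘ₗ V.subtype.prodMap V.subtype
  let φ : Dbl H →ₗ[ℝ] (F → ℝ) :=
    LinearMap.pi fun i => (innerSL ℝ (b i) : Dbl H →ₗ[ℝ] ℝ) ∘ₗ (N : Dbl H →ₗ[ℝ] Dbl H)
  let Φ : V × V →ₗ[ℝ] (F → ℝ) × (F → ℝ) :=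
    (φ.prod (φ ∘ₗ (J H : Dbl H →ₗ[ℝ] Dbl H))) ∘ₗ e
  have hker : LinearMap.ker Φ ≠ ⊥ := by
    refine LinearMap.ker_ne_bot_of_finrank_lt ?_
    rw [Module.finrank_prod, Module.finrank_prod, hV, Module.finrank_fintype_fun_eq_card,
      ← Nat.card_eq_fintype_card, Nat.card_coe_set_eq]
    omega
  obtain ⟨⟨x, y⟩, hxy, hne⟩ := Submodule.exists_mem_ne_zero_of_ne_bot hker
  have hker1 : ∀ i : F, inner ℝ (b i) (N (e (x, y))) = 0 := fun i =>
    congrFun (congrArg Prod.fst hxy) i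
  have hker2 : ∀ i : F, inner ℝ (b i) (N (J H (e (x, y)))) = 0 := fun i =>
    congrFun (congrArg Prod.snd hxy) i
  refine ⟨e (x, y), fun h0 => hne ?_, fun i hi => ?_, fun i hi => ?_,
    fun i hi hc => hi (hker1 ⟨i, hc⟩), fun i hi hc => hi (hker2 ⟨i, hc⟩)⟩
  · refine Prod.ext (Subtype.ext ?_) (Subtype.ext ?_)
    · exact congrArg WithLp.fst h0
    · exact congrArg WithLp.snd h0
  · exact mem_of_mem_span_eigenvectors hD hh hvI x.2 hi
  · exact mem_of_mem_span_eigenvectors hD hh hvI y.2 hi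

/-- With `p - i q` for a vector of the complexification, this is the inequality `iJ ≤ 1` in real
terms. -/
theorem two_mul_norm_sq_le {p q z : Dbl H} (h : inner ℝ p (J H q) = -‖z‖ ^ 2) :
    2 * ‖z‖ ^ 2 ≤ ‖p‖ ^ 2 + ‖q‖ ^ 2 := by
  have h1 := norm_add_sq_real p (J H q)
  rw [h, norm_J_apply] at h1
  have := sq_nonneg ‖p + J H q‖
  linarith

variable [CompleteSpace H]

/-- `J S` is similar to `J (D ⊕ D)` and so `-(J S)²` to `D² ⊕ D²`. -/
theorem isCompactOperator_sq_sub_one {S M : Dbl H →L[ℝ] Dbl H} {D : H →L[ℝ] H}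
    (hM : IsSymplectic M) (hSM : S = M.adjoint * diag D * M) (hc : IsCompactOperator ⇑(S - 1)) :
    IsCompactOperator ⇑(D * D - 1) := by
  obtain ⟨N, hNM⟩ := hM.1.exists_left_inv
  obtain ⟨N', hMN'⟩ := hM.1.exists_right_inv
  have hMN : M * N = 1 := by rwa [left_inv_eq_right_inv hNM hMN']
  have hMJM := (isSymplectic_iff hM.1).1 hM
  have h1 : M * (J H * S) * N = J H * diag D := by
    rw [hSM]
    calc _ = M * J H * M.adjoint * diag D * (M * N) := by simp only [mul_assoc]
      _ = _ := by rw [hMJM, hMN, mul_one]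
  have h2 : J H * (S - 1) * (J H * S) - (S - 1) = J H * S * (J H * S) + 1 := by
    simp only [mul_sub, sub_mul, mul_assoc, mul_one, J_mul_J_mul]
    abel
  have h3 : M * (J H * S * (J H * S) + 1) * N = -(diag (D * D) - 1) := by
    calc _ = M * (J H * S) * (N * M) * (J H * S) * N + M * N := by
          rw [hNM]
          simp only [mul_add, add_mul, mul_assoc, one_mul]
      _ = M * (J H * S) * N * (M * (J H * S) * N) + M * N := by simp only [mul_assoc]
      _ = _ := by
          rw [h1, hMN, mul_assoc, ← mul_assoc (diag D), diag_mul_J, mul_assoc, J_mul_J_mul,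
            diag_mul]
          abel
  have h4 : IsCompactOperator ⇑(diag (D * D) - 1) := by
    have h5 := (((((hc.clm_comp (J H)).comp_clm (J H * S)).sub hc).clm_comp M).comp_clm N).neg
    have h6 : -(M * (J H * (S - 1) * (J H * S) - (S - 1)) * N) = diag (D * D) - 1 := by
      rw [h2, h3, neg_neg]
    rw [← h6]
    exact h5
  exact (h4.clm_comp (WithLp.fstL 2 ℝ H H)).comp_clm
    (((WithLp.prodContinuousLinearEquiv 2 ℝ H H).symm : H × H →L[ℝ] Dbl H) ∘L
      ContinuousLinearMap.inl ℝ H H)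

/-- The eigenvectors of `D²` are eigenvectors of `D` because `D + √μ` is injective for `μ > 0`. -/
theorem exists_eigenbasis_of_sq.{u} {K : Type u} [NormedAddCommGroup K] [InnerProductSpace ℝ K]
    [CompleteSpace K] {D : K →L[ℝ] K} (hD : D.IsPositive) (hu : IsUnit D)
    (hc : IsCompactOperator ⇑(D * D - 1)) :
    ∃ (ι : Type u) (b : HilbertBasis ι ℝ K) (c : ι → ℝ), (∀ i, D (b i) = c i • b i) ∧
      ∀ i, 0 ≤ c i ∧ c i ≤ ‖D‖ := by
  have hDs : ∀ x y, inner ℝ (D x) y = inner ℝ x (D y) := hD.isSymmetric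
  have hsym : (D * D).IsSymmetric := fun x y => (hDs _ _).trans (hDs _ _)
  obtain ⟨ι, b, c, hb⟩ := exists_hilbertBasis_eigenvectors hsym hc
  obtain ⟨D', hD'⟩ := hu.exists_left_inv
  have hne : ∀ i, b i ≠ 0 := fun i => b.orthonormal.ne_zero i
  have hDb : ∀ i, D (b i) = √(c i) • b i := by
    intro i
    have hbi : D (D (b i)) = c i • b i := hb i
    have hpos : 0 < c i := by
      have h1 : c i = ‖D (b i)‖ ^ 2 := by
        rw [← real_inner_self_eq_norm_sq, hDs, hbi, real_inner_smul_right,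
          real_inner_self_eq_norm_sq, b.orthonormal.1]
        ring
      rw [h1]
      have h2 : D (b i) ≠ 0 := fun h => hne i (by
        have := DFunLike.congr_fun hD' (b i)
        change D' (D (b i)) = b i at this
        rw [← this, h, map_zero])
      positivity
    set y := D (b i) - √(c i) • b i with hy
    have hDy : D y = -(√(c i) • y) := by
      rw [hy, map_sub, map_smul, hbi, smul_sub, smul_smul, Real.mul_self_sqrt hpos.le]
      abel
    have h3 := hD.inner_nonneg_right y
    rw [hDy, inner_neg_right, real_inner_smul_right, real_inner_self_eq_norm_sq] at h3
    have h4 : ‖y‖ ^ 2 ≤ 0 := by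
      have := Real.sqrt_pos.2 hpos
      by_contra h
      have := mul_pos this (not_le.1 h)
      linarith
    have h5 : y = 0 := norm_eq_zero.1 (pow_eq_zero_iff two_ne_zero |>.1
      (le_antisymm h4 (by positivity)))
    exact sub_eq_zero.1 h5
  exact ⟨ι, b, fun i => √(c i), hDb,
    fun i => ⟨Real.sqrt_nonneg _, eigenvalue_le_norm (hne i) (hDb i)⟩⟩

theorem isPositive_of_isWilliamson {S : Dbl H →L[ℝ] Dbl H} {D : H →L[ℝ] H}
    (h : IsWilliamson S D) : S.IsPositive := by
  obtain ⟨hD, -, M, -, rfl⟩ := h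
  refine ContinuousLinearMap.IsPositive.adjoint_conj (T := diag D) ?_ M
  refine (ContinuousLinearMap.isPositive_iff _).2 ⟨fun z w => ?_, fun z => ?_⟩
  · exact congrArg₂ (· + ·) (hD.isSymmetric _ _) (hD.isSymmetric _ _)
  · exact add_nonneg (hD.inner_nonneg_left _) (hD.inner_nonneg_left _)

end Williamson

/-! ### Comparison of symplectic and ordinary eigenvalues -/

section Comparison

variable {H : Type*} [NormedAddCommGroup H] [InnerProductSpace ℝ H]

theorem inner_diag_J (D : H →L[ℝ] H) (z : Dbl H) :
    inner ℝ (J H z) (diag D (J H z)) = inner ℝ z (diag D z) := by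
  simp only [inner_dbl, J_apply_fst, J_apply_snd, diag_apply_fst, diag_apply_snd, map_neg,
    inner_neg_neg]
  ring

/-- `quadratic_nonneg` for `D ⊕ D`. -/
theorem quadratic_diag_nonneg {D : H →L[ℝ] H} (hD : D.IsSymmetric) {ι : Type*}
    {h : HilbertBasis ι ℝ H} {c : ι → ℝ} (hh : ∀ i, D (h i) = c i • h i) {z : Dbl H} {α β γ : ℝ}
    (h1 : ∀ i, inner ℝ (h i) z.fst ≠ 0 → 0 ≤ α + β * c i + γ * c i ^ 2)
    (h2 : ∀ i, inner ℝ (h i) z.snd ≠ 0 → 0 ≤ α + β * c i + γ * c i ^ 2) :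
    0 ≤ α * ‖z‖ ^ 2 + β * inner ℝ z (diag D z) + γ * ‖diag D z‖ ^ 2 := by
  have h3 := quadratic_nonneg hD hh h1
  have h4 := quadratic_nonneg hD hh h2
  simp only [← real_inner_self_eq_norm_sq, inner_dbl, diag_apply_fst, diag_apply_snd] at h3 h4 ⊢
  linarith

variable [CompleteSpace H]

/-- `N = M⁻¹` satisfies `Nᵀ J N = J`. -/
theorem inner_inverse_J {M N : Dbl H →L[ℝ] Dbl H} (hM : IsSymplectic M) (hMN : M * N = 1)
    (z : Dbl H) : inner ℝ (N z) (J H (N (J H z))) = -‖z‖ ^ 2 := by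
  have hMN' : ∀ x, M (N x) = x := fun x => DFunLike.congr_fun hMN x
  have hMJM : ∀ x, M.adjoint (J H (M x)) = J H x := fun x => DFunLike.congr_fun hM.2 x
  rw [← hMJM, hMN', ContinuousLinearMap.adjoint_inner_right, hMN', J_J_apply, inner_neg_right,
    real_inner_self_eq_norm_sq]

/-- `Mᵀ` satisfies `M J Mᵀ = J`. -/
theorem inner_adjoint_J {M : Dbl H →L[ℝ] Dbl H} (hM : IsSymplectic M) (z : Dbl H) :
    inner ℝ (M.adjoint z) (J H (M.adjoint (J H z))) = -‖z‖ ^ 2 := by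
  have hMJM : ∀ x, M (J H (M.adjoint x)) = J H x := fun x =>
    DFunLike.congr_fun ((isSymplectic_iff hM.1).1 hM) x
  rw [ContinuousLinearMap.adjoint_inner_left, hMJM, J_J_apply, inner_neg_right,
    real_inner_self_eq_norm_sq]

variable {S : Dbl H →L[ℝ] Dbl H} {D : H →L[ℝ] H} {ι ι' : Type*} {h : HilbertBasis ι ℝ H}
  {b : HilbertBasis ι' ℝ (Dbl H)} {c : ι → ℝ} {c' : ι' → ℝ}

/-- With `p = N z`, `q = N J z`, `N = M⁻¹`, the assumption that `S` has fewer than `j` eigenvalues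
`≤ y` gives `y (‖p‖² + ‖q‖²) ≤ 2 ⟪z, (D ⊕ D) z⟫ ≤ 2 x ‖z‖²`, while `2 ‖z‖² ≤ ‖p‖² + ‖q‖²`. -/
theorem IsWilliamson.hasEigenvaluesIn_Iic (hW : IsWilliamson S D)
    (hh : ∀ i, D (h i) = c i • h i) (hb : ∀ i, S (b i) = c' i • b i) {j : ℕ} {x y : ℝ}
    (hy : 0 ≤ y) (hxy : x < y) (hD : HasEigenvaluesIn D j (Set.Iic x)) :
    HasEigenvaluesIn S j (Set.Iic y) := by
  have hS := isPositive_of_isWilliamson hW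
  obtain ⟨hDp, hDu, M, hM, hSM⟩ := hW
  obtain ⟨N, hMN⟩ := hM.1.exists_right_inv
  have hMN' : ∀ x, M (N x) = x := fun x => DFunLike.congr_fun hMN x
  by_contra hno
  obtain ⟨z, hz, hz1, hz2, hp, hq⟩ := exists_common_vector N hDp.isSymmetric hh hb hD hno
  have hform : ∀ z, inner ℝ (N z) (S (N z)) = inner ℝ z (diag D z) := fun z => by
    have : S (N z) = M.adjoint (diag D (M (N z))) := by rw [hSM]; rfl
    rw [this, ContinuousLinearMap.adjoint_inner_right, hMN']
  have hlow : ∀ p, (∀ i, inner ℝ (b i) p ≠ 0 → c' i ∉ Set.Iic y) →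
      0 ≤ -y * ‖p‖ ^ 2 + 1 * inner ℝ p (S p) + 0 * ‖S p‖ ^ 2 := fun p hp =>
    quadratic_nonneg hS.isSymmetric hb fun i hi => by
      have : y < c' i := not_le.1 fun hle => hp i hi hle
      linarith
  have h1 := hlow _ hp
  have h2 := hlow _ hq
  rw [hform] at h1 h2
  rw [inner_diag_J] at h2
  have h3 := quadratic_diag_nonneg (α := x) (β := -1) (γ := 0) hDp.isSymmetric hh
    (fun i hi => by have : c i ≤ x := hz1 i hi; linarith)
    (fun i hi => by have : c i ≤ x := hz2 i hi; linarith)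
  have h4 := mul_le_mul_of_nonneg_left (two_mul_norm_sq_le (inner_inverse_J hM hMN z)) hy
  have h5 : 0 < (y - x) * ‖z‖ ^ 2 := mul_pos (sub_pos.2 hxy) (by positivity)
  linarith

/-- The same dimension count as in `IsWilliamson.hasEigenvaluesIn_Iic`, with `S p` and `S q` in
place of `p` and `q`: now `2 ‖(D ⊕ D) z‖² ≤ ‖S p‖² + ‖S q‖² ≤ 2 y ⟪z, (D ⊕ D) z⟫`. -/
theorem IsWilliamson.hasEigenvaluesIn_Ici (hW : IsWilliamson S D)
    (hh : ∀ i, D (h i) = c i • h i) (hc : ∀ i, 0 ≤ c i) (hb : ∀ i, S (b i) = c' i • b i) {j : ℕ}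
    {x y : ℝ} (hxy : y < x) (hD : HasEigenvaluesIn D j (Set.Ici x)) :
    HasEigenvaluesIn S j (Set.Ici y) := by
  have hS := isPositive_of_isWilliamson hW
  obtain ⟨hDp, hDu, M, hM, hSM⟩ := hW
  obtain ⟨N, hMN⟩ := hM.1.exists_right_inv
  have hMN' : ∀ x, M (N x) = x := fun x => DFunLike.congr_fun hMN x
  by_contra hno
  obtain ⟨z, hz, hz1, hz2, hp, hq⟩ := exists_common_vector N hDp.isSymmetric hh hb hD hno
  have hSN : ∀ z, S (N z) = M.adjoint (diag D z) := fun z => by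
    have : S (N z) = M.adjoint (diag D (M (N z))) := by rw [hSM]; rfl
    rw [this, hMN']
  have hform : ∀ z, inner ℝ (N z) (S (N z)) = inner ℝ z (diag D z) := fun z => by
    rw [hSN, ContinuousLinearMap.adjoint_inner_right, hMN']
  have hlow : ∀ p, (∀ i, inner ℝ (b i) p ≠ 0 → c' i ∉ Set.Ici y) →
      0 ≤ 0 * ‖p‖ ^ 2 + y * inner ℝ p (S p) + -1 * ‖S p‖ ^ 2 := fun p hp =>
    quadratic_nonneg hS.isSymmetric hb fun i hi => by
      have h1 : c' i < y := not_le.1 fun hle => hp i hi hle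
      have h2 := eigenvalue_nonneg hS (b.orthonormal.ne_zero i) (hb i)
      have := mul_nonneg h2 (sub_nonneg.2 h1.le)
      linarith
  have h1 := hlow _ hp
  have h2 := hlow _ hq
  rw [hform] at h1 h2
  rw [inner_diag_J] at h2
  have hpoly : ∀ i, c i ∈ Set.Ici x → 0 ≤ 0 + -x * c i + 1 * c i ^ 2 := fun i hi => by
    have := mul_nonneg (hc i) (sub_nonneg.2 (Set.mem_Ici.1 hi))
    linarith
  have h3 := quadratic_diag_nonneg (z := z) hDp.isSymmetric hh (fun i hi => hpoly i (hz1 i hi))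
    (fun i hi => hpoly i (hz2 i hi))
  have h4 := inner_adjoint_J hM (diag D z)
  have hDJ : J H (diag D z) = diag D (J H z) := (DFunLike.congr_fun (diag_mul_J D) z).symm
  rw [hDJ, ← hSN, ← hSN] at h4
  have h5 := two_mul_norm_sq_le h4
  have h6 : 0 ≤ inner ℝ z (diag D z) :=
    add_nonneg (hDp.inner_nonneg_right _) (hDp.inner_nonneg_right _)
  -- Both `‖(D ⊕ D) z‖² ≤ y ⟪z, (D ⊕ D) z⟫` and `x ⟪z, (D ⊕ D) z⟫ ≤ ‖(D ⊕ D) z‖²`, which forces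
  -- `(D ⊕ D) z = 0`.
  have h7 : inner ℝ z (diag D z) = 0 := by
    by_contra hne
    have := mul_pos (sub_pos.2 hxy) (lt_of_le_of_ne h6 (Ne.symm hne))
    linarith
  rw [h7] at h1 h2
  have h8 : diag D z = 0 :=
    norm_eq_zero.1 (pow_eq_zero_iff two_ne_zero |>.1 (le_antisymm (by linarith) (sq_nonneg _)))
  obtain ⟨D', hD'⟩ := hDu.exists_left_inv
  have hinj : ∀ a, D a = 0 → a = 0 := fun a ha => by
    have h9 : D' (D a) = a := DFunLike.congr_fun hD' a
    rw [← h9, ha, map_zero]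
  exact hz (dbl_ext (hinj _ (congrArg WithLp.fst h8)) (hinj _ (congrArg WithLp.snd h8)))

end Comparison

end GaussianCov

theorem theorem3p2 {H : Type*} [NormedAddCommGroup H] [InnerProductSpace ℝ H] [CompleteSpace H]
    [TopologicalSpace.SeparableSpace H]
    (S : GaussianCov.Dbl H →L[ℝ] GaussianCov.Dbl H) (hS : GaussianCov.IsGCO S) :
    (∃ D : H →L[ℝ] H, GaussianCov.IsWilliamson S D) ∧
    ∀ D : H →L[ℝ] H, GaussianCov.IsWilliamson S D →
      ∀ j : ℕ, 1 ≤ j → (j : Cardinal) ≤ Module.rank ℝ H →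
        GaussianCov.eigDown D j ≤ GaussianCov.eigDown S j ∧
        GaussianCov.eigUp S j ≤ GaussianCov.eigUp D j := by
  have hc := hS.hilbertSchmidt.isCompactOperator
  -- Only the square root `R = √S` is taken from the trace class condition: the compactness of
  -- `(√S J √S)ᵀ (√S J √S) - 1` already follows from that of `S - 1`.
  obtain ⟨R, hR, -⟩ := hS.traceClass
  refine ⟨GaussianCov.exists_isWilliamson hR hS.inv hc, fun D hW j hj hjr => ?_⟩
  have hSp := GaussianCov.isPositive_of_isWilliamson hW
  obtain ⟨hDp, hDu, M, hM, hSM⟩ := id hW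
  obtain ⟨ι, h, c, hh, hcb⟩ := GaussianCov.exists_eigenbasis_of_sq hDp hDu
    (GaussianCov.isCompactOperator_sq_sub_one hM hSM hc)
  obtain ⟨ι', b, c', hb⟩ := GaussianCov.exists_hilbertBasis_eigenvectors hS.symm hc
  constructor
  · have hne : GaussianCov.HasEigenvaluesIn D j (Set.Ici 0) :=
      GaussianCov.hasEigenvaluesIn_of_le_rank hh hjr fun i => (hcb i).1
    -- `D` has `j` eigenvalues at all, so that both suprema are over nonempty sets.
    refine csSup_le ⟨0, hne⟩ fun x hx => le_of_forall_lt fun y hy => ?_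
    obtain ⟨y', hyy', hy'x⟩ := exists_between hy
    exact hyy'.trans_le (le_csSup (GaussianCov.bddAbove_hasEigenvaluesIn S hj)
      (hW.hasEigenvaluesIn_Ici hh (fun i => (hcb i).1) hb hy'x hx))
  · have hne : GaussianCov.HasEigenvaluesIn D j (Set.Iic ‖D‖) :=
      GaussianCov.hasEigenvaluesIn_of_le_rank hh hjr fun i => (hcb i).2
    refine le_csInf ⟨_, hne⟩ fun x hx => le_of_forall_gt fun y hy => ?_
    obtain ⟨y', hxy', hy'y⟩ := exists_between hy
    have hx0 := GaussianCov.nonneg_of_hasEigenvaluesIn_Iic hDp hj hx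
    have hbdd : BddBelow {x | GaussianCov.HasEigenvaluesIn S j (Set.Iic x)} :=
      ⟨0, fun x hx => GaussianCov.nonneg_of_hasEigenvaluesIn_Iic hSp hj hx⟩
    exact (csInf_le hbdd
      (hW.hasEigenvaluesIn_Iic hh hb (hx0.trans hxy'.le) hxy' hx)).trans_lt hy'y
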